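/- A subgroup $H$ of a group $G$ is said to strongly control fusion in $G$ if for any two subsets $B_1, B_2 \subseteq H$ and any $g \in G$ with $g B_1 g^{-1} = B_2$, there exists $h \in H$ such that $g b g^{-1} = h b h^{-1}$ for all $b \in B_1$. Proposition. For every integer $n \ge 2$, the (compact, real) special orthogonal group $\mathrm{SO}(2n-1)$, regarded as a subgroup of $\mathrm{SO}(2n)$ via the standard embedding $A \mapsto \begin{pmatrix} A & 0 \\ 0 & 1 \end{pmatrix}$, strongly controls fusion in $\mathrm{SO}(2n)$. -/

import Mathlib

/-- A subgroup `H` of a group `G` strongly controls fusion in `G` if, whenever `B₁, B₂ ⊆ H` and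
`g ∈ G` satisfy `g B₁ g⁻¹ = B₂`, there is `h ∈ H` such that `g b g⁻¹ = h b h⁻¹` for all `b ∈ B₁`. -/
def StronglyControlsFusion {G : Type*} [Group G] (H : Subgroup G) : Prop :=
  ∀ B₁ B₂ : Set G, B₁ ⊆ (H : Set G) → B₂ ⊆ (H : Set G) →
    ∀ g : G, (fun b => g * b * g⁻¹) '' B₁ = B₂ →
      ∃ h ∈ H, ∀ b ∈ B₁, g * b * g⁻¹ = h * b * h⁻¹

/-- The block-diagonal matrix `diag(A, 1)` of size `k + 1 = m`. -/
def extendByOne {k m : ℕ} (hkm : k + 1 = m) (A : Matrix (Fin k) (Fin k) ℝ) :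
    Matrix (Fin m) (Fin m) ℝ :=
  Matrix.reindex (finSumFinEquiv.trans (finCongr hkm)) (finSumFinEquiv.trans (finCongr hkm))
    (Matrix.fromBlocks A 0 0 (1 : Matrix (Fin 1) (Fin 1) ℝ))

theorem extendByOne_one {k m : ℕ} (hkm : k + 1 = m) : extendByOne hkm 1 = 1 := by
  rw [extendByOne, Matrix.fromBlocks_one, Matrix.reindex_apply, Matrix.submatrix_one_equiv]

theorem extendByOne_mul {k m : ℕ} (hkm : k + 1 = m) (A B : Matrix (Fin k) (Fin k) ℝ) :
    extendByOne hkm (A * B) = extendByOne hkm A * extendByOne hkm B := by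
  simp only [extendByOne, Matrix.reindex_apply, Matrix.submatrix_mul_equiv,
    Matrix.fromBlocks_multiply]
  simp

theorem extendByOne_mem {k m : ℕ} (hkm : k + 1 = m) {A : Matrix (Fin k) (Fin k) ℝ}
    (hA : A ∈ Matrix.specialOrthogonalGroup (Fin k) ℝ) :
    extendByOne hkm A ∈ Matrix.specialOrthogonalGroup (Fin m) ℝ := by
  rw [Matrix.mem_specialOrthogonalGroup_iff, Matrix.mem_orthogonalGroup_iff] at hA ⊢
  obtain ⟨h1, h2⟩ := hA
  refine ⟨?_, ?_⟩
  · have hs : (extendByOne hkm A).transpose = extendByOne hkm A.transpose := by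
      simp [extendByOne, Matrix.fromBlocks_transpose]
    rw [hs, ← extendByOne_mul, h1, extendByOne_one]
  · rw [extendByOne, Matrix.det_reindex_self, Matrix.det_fromBlocks_zero₂₁, h2, Matrix.det_one,
      mul_one]

/-- The standard embedding `SO(k) → SO(k + 1)`, `A ↦ diag(A, 1)`, of real special orthogonal
groups. -/
def specialOrthogonalEmbedding {k m : ℕ} (hkm : k + 1 = m) :
    Matrix.specialOrthogonalGroup (Fin k) ℝ →* Matrix.specialOrthogonalGroup (Fin m) ℝ where
  toFun A := ⟨extendByOne hkm A.1, extendByOne_mem hkm A.2⟩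
  map_one' := Subtype.ext (extendByOne_one hkm)
  map_mul' A B := Subtype.ext (extendByOne_mul hkm A.1 B.1)

open Matrix

/-! The embedded SO(m - 1) is the stabilizer of the last basis vector e. If b and its conjugate by g
both lie there, then b fixes e and v = g⁻¹e, which have equal length. It suffices to find a rotation
C with Ce = v commuting with every such b: then h = gC fixes e and conjugates each b as g does.
Reflections in vectors fixed by b commute with b, so C is built from those in e and e - v
(`exists_rotation_commute`); evenness of m makes -1 a rotation. -/

/-- The matrix of the orthogonal reflection in the hyperplane orthogonal to `w`. -/
noncomputable def householder {ι : Type*} [Fintype ι] [DecidableEq ι] (w : ι → ℝ) :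
    Matrix ι ι ℝ :=
  1 - (2 / (w ⬝ᵥ w)) • vecMulVec w w

section Householder

variable {ι : Type*} [Fintype ι] [DecidableEq ι]

theorem transpose_householder (w : ι → ℝ) : (householder w)ᵀ = householder w := by
  simp [householder, transpose_vecMulVec]

theorem householder_mulVec (w x : ι → ℝ) :
    householder w *ᵥ x = x - (2 / (w ⬝ᵥ w) * (w ⬝ᵥ x)) • w := by
  ext i
  simp [householder, sub_mulVec, smul_mulVec, vecMulVec_mulVec]
  ring

theorem householder_mul_self {w : ι → ℝ} (hw : w ≠ 0) : householder w * householder w = 1 := by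
  have hww : w ⬝ᵥ w ≠ 0 := fun h => hw (dotProduct_self_eq_zero.mp h)
  refine ext_of_mulVec_single fun i => ?_
  rw [← mulVec_mulVec, one_mulVec, householder_mulVec, householder_mulVec, dotProduct_sub,
    dotProduct_smul, smul_eq_mul, sub_sub, ← add_smul, sub_eq_self]
  have hcoeff : ∀ t : ℝ, 2 / (w ⬝ᵥ w) * t +
      2 / (w ⬝ᵥ w) * (t - 2 / (w ⬝ᵥ w) * t * (w ⬝ᵥ w)) = 0 := by
    intro t
    field_simp
    ring
  rw [hcoeff, zero_smul]

/-- Matrix determinant lemma: det(1 + uvᵀ) = 1 + v ⬝ u, which here is 1 - 2. -/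
theorem det_householder {w : ι → ℝ} (hw : w ≠ 0) : (householder w).det = -1 := by
  have hww : w ⬝ᵥ w ≠ 0 := fun h => hw (dotProduct_self_eq_zero.mp h)
  have h : householder w = 1 + vecMulVec ((-(2 / (w ⬝ᵥ w))) • w) w := by
    rw [householder, smul_vecMulVec, neg_smul, sub_eq_add_neg]
  rw [h, vecMulVec_eq Unit, det_one_add_replicateCol_mul_replicateRow, dotProduct_smul,
    smul_eq_mul]
  field_simp
  norm_num

/-- Equal lengths give 2(x - y) ⬝ x = (x - y) ⬝ (x - y), so the reflection subtracts exactly x - y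
from x. -/
theorem householder_sub_mulVec {x y : ι → ℝ} (hxy : x ⬝ᵥ x = y ⬝ᵥ y) (hne : x ≠ y) :
    householder (x - y) *ᵥ x = y := by
  have hww : (x - y) ⬝ᵥ (x - y) ≠ 0 := fun h =>
    sub_ne_zero.mpr hne (dotProduct_self_eq_zero.mp h)
  have htwo : 2 * ((x - y) ⬝ᵥ x) = (x - y) ⬝ᵥ (x - y) := by
    simp only [sub_dotProduct, dotProduct_sub, dotProduct_comm y x]
    linarith
  rw [householder_mulVec, div_mul_eq_mul_div, htwo, div_self hww, one_smul, sub_sub_cancel]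

theorem householder_self_mulVec {x : ι → ℝ} (hx : x ≠ 0) : householder x *ᵥ x = -x := by
  have hxx : x ⬝ᵥ x ≠ 0 := fun h => hx (dotProduct_self_eq_zero.mp h)
  rw [householder_mulVec, div_mul_cancel₀ _ hxx, two_smul]
  abel

/-- An orthogonal matrix fixing a vector has a transpose fixing it. -/
theorem vecMul_eq_of_mulVec_eq {A : Matrix ι ι ℝ} (hA : Aᵀ * A = 1) {w : ι → ℝ}
    (hw : A *ᵥ w = w) : w ᵥ* A = w := by
  rw [← mulVec_transpose]
  conv_lhs => rw [← hw]
  rw [mulVec_mulVec, hA, one_mulVec]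

theorem commute_householder {A : Matrix ι ι ℝ} (hA : Aᵀ * A = 1) {w : ι → ℝ}
    (hw : A *ᵥ w = w) : Commute A (householder w) := by
  have h : Commute A (vecMulVec w w) := by
    rw [commute_iff_eq, mul_vecMulVec, vecMulVec_mul, hw, vecMul_eq_of_mulVec_eq hA hw]
  exact (Commute.one_right A).sub_right (h.smul_right _)

theorem householder_mem_orthogonalGroup {w : ι → ℝ} (hw : w ≠ 0) :
    householder w ∈ orthogonalGroup ι ℝ := by
  rw [mem_orthogonalGroup_iff, transpose_householder, householder_mul_self hw]

theorem transpose_mul_self_of_mem {A : Matrix ι ι ℝ} (hA : A ∈ specialOrthogonalGroup ι ℝ) :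
    Aᵀ * A = 1 :=
  (mem_orthogonalGroup_iff' _ _).mp (mem_specialOrthogonalGroup_iff.mp hA).1

/-- In even dimension, two vectors of equal length are related by a rotation commuting with every
orthogonal matrix that fixes both of them. -/
theorem exists_rotation_commute (hι : Even (Fintype.card ι)) {x y : ι → ℝ} (hx : x ≠ 0)
    (hxy : x ⬝ᵥ x = y ⬝ᵥ y) :
    ∃ C ∈ specialOrthogonalGroup ι ℝ, C *ᵥ x = y ∧
      ∀ A : Matrix ι ι ℝ, Aᵀ * A = 1 → A *ᵥ x = x → A *ᵥ y = y → Commute A C := by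
  -- For x = y the first factor of the product below would degenerate to 1, leaving determinant -1.
  rcases eq_or_ne x y with rfl | hne
  · exact ⟨1, one_mem _, one_mulVec x, fun A _ _ _ => Commute.one_right A⟩
  have hw : x - y ≠ 0 := sub_ne_zero.mpr hne
  -- The reflection in x sends x to -x, the one in x - y sends -x to -y, and the sign restores y.
  refine ⟨-(householder (x - y) * householder x), ?_, ?_, fun A hA hAx hAy => ?_⟩
  · rw [mem_specialOrthogonalGroup_iff]
    constructor
    · have h := mul_mem (householder_mem_orthogonalGroup hw) (householder_mem_orthogonalGroup hx)
      rw [mem_orthogonalGroup_iff] at h ⊢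
      rwa [transpose_neg, neg_mul_neg]
    · rw [det_neg, hι.neg_one_pow, det_mul, det_householder hw, det_householder hx]
      norm_num
  · rw [neg_mulVec, ← mulVec_mulVec, householder_self_mulVec hx, mulVec_neg, neg_neg,
      householder_sub_mulVec hxy hne]
  · have hAw : A *ᵥ (x - y) = x - y := by rw [mulVec_sub, hAx, hAy]
    exact ((commute_householder hA hAw).mul_right (commute_householder hA hAx)).neg_right

end Householder

/-- The vector fixed by all the matrices `diag(A, 1)`. -/
def lastVector {k m : ℕ} (hkm : k + 1 = m) : Fin m → ℝ :=
  Pi.single (finSumFinEquiv.trans (finCongr hkm) (Sum.inr (0 : Fin 1))) 1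

theorem lastVector_ne_zero {k m : ℕ} (hkm : k + 1 = m) : lastVector hkm ≠ 0 := by
  simp [lastVector]

theorem extendByOne_mulVec_lastVector {k m : ℕ} (hkm : k + 1 = m)
    (A : Matrix (Fin k) (Fin k) ℝ) : extendByOne hkm A *ᵥ lastVector hkm = lastVector hkm := by
  ext i
  obtain ⟨j, rfl⟩ := (finSumFinEquiv.trans (finCongr hkm)).surjective i
  rw [lastVector, mulVec_single_one, col_apply, extendByOne, reindex_apply, submatrix_apply,
    Equiv.symm_apply_apply, Equiv.symm_apply_apply]
  rcases j with j | j
  · rw [fromBlocks_apply₁₂, Pi.single_eq_of_ne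
      ((Equiv.injective _).ne Sum.inl_ne_inr), Matrix.zero_apply]
  · rw [Subsingleton.elim j 0, fromBlocks_apply₂₂, Pi.single_eq_same, one_apply_eq]

theorem extendByOne_injective {k m : ℕ} (hkm : k + 1 = m) :
    Function.Injective (extendByOne hkm) := by
  intro A B h
  exact (fromBlocks_inj.mp ((reindex _ _).injective h)).1

/-- The two hypotheses prescribe the last column and the last row, leaving only the upper left block
free. -/
theorem exists_extendByOne_eq {k m : ℕ} (hkm : k + 1 = m) {M : Matrix (Fin m) (Fin m) ℝ}
    (hcol : M *ᵥ lastVector hkm = lastVector hkm)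
    (hrow : lastVector hkm ᵥ* M = lastVector hkm) : ∃ A, extendByOne hkm A = M := by
  set f : Fin k ⊕ Fin 1 ≃ Fin m := finSumFinEquiv.trans (finCongr hkm) with hf
  have hc : ∀ i, M i (f (Sum.inr 0)) = (Pi.single (f (Sum.inr 0)) 1 : Fin m → ℝ) i := by
    intro i
    have h := congrFun hcol i
    rwa [lastVector, mulVec_single_one] at h
  have hr : ∀ i, M (f (Sum.inr 0)) i = (Pi.single (f (Sum.inr 0)) 1 : Fin m → ℝ) i := by
    intro i
    have h := congrFun hrow i
    rwa [lastVector, single_one_vecMul] at h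
  refine ⟨(M.submatrix f f).toBlocks₁₁, ?_⟩
  rw [extendByOne, ← hf, ← Equiv.eq_symm_apply, reindex_symm, reindex_apply, Equiv.symm_symm]
  ext i j
  rcases i with i | i <;> rcases j with j | j
  · rfl
  · rw [Subsingleton.elim j 0, submatrix_apply, hc,
      Pi.single_eq_of_ne (f.injective.ne Sum.inl_ne_inr)]
    rfl
  · rw [Subsingleton.elim i 0, submatrix_apply, hr,
      Pi.single_eq_of_ne (f.injective.ne Sum.inl_ne_inr)]
    rfl
  · rw [Subsingleton.elim i 0, Subsingleton.elim j 0, submatrix_apply, hc, Pi.single_eq_same,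
      fromBlocks_apply₂₂, one_apply_eq]

/-- The embedded copy of `SO(k)` is the stabilizer of the last vector. -/
theorem mem_range_specialOrthogonalEmbedding_iff {k m : ℕ} (hkm : k + 1 = m)
    (g : specialOrthogonalGroup (Fin m) ℝ) :
    g ∈ (specialOrthogonalEmbedding hkm).range ↔
      g.1 *ᵥ lastVector hkm = lastVector hkm := by
  constructor
  · rintro ⟨A, rfl⟩
    exact extendByOne_mulVec_lastVector hkm A.1
  · intro h
    have hg := transpose_mul_self_of_mem g.2
    obtain ⟨A, hA⟩ := exists_extendByOne_eq hkm h (vecMul_eq_of_mulVec_eq hg h)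
    have hdet : (extendByOne hkm A).det = 1 := by
      rw [hA]
      exact (mem_specialOrthogonalGroup_iff.mp g.2).2
    have hT : (extendByOne hkm A)ᵀ = extendByOne hkm Aᵀ := by
      simp [extendByOne, fromBlocks_transpose]
    refine ⟨⟨A, mem_specialOrthogonalGroup_iff.mpr ⟨?_, ?_⟩⟩, Subtype.ext hA⟩
    · refine (mem_orthogonalGroup_iff' _ _).mpr (extendByOne_injective hkm ?_)
      rw [extendByOne_mul, ← hT, hA, hg, extendByOne_one]
    · rwa [extendByOne, det_reindex_self, det_fromBlocks_zero₂₁, det_one, mul_one] at hdet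

theorem stronglyControlsFusion_range_specialOrthogonalEmbedding {k m : ℕ} (hkm : k + 1 = m)
    (hm : Even m) : StronglyControlsFusion (specialOrthogonalEmbedding hkm).range := by
  intro B₁ B₂ h₁ h₂ g hg
  set e := lastVector hkm with he
  have hmul : ∀ (a b : specialOrthogonalGroup (Fin m) ℝ) (x : Fin m → ℝ),
      (a * b).1 *ᵥ x = a.1 *ᵥ (b.1 *ᵥ x) := fun a b x => (mulVec_mulVec x a.1 b.1).symm
  have hcancel : ∀ x : Fin m → ℝ, g.1 *ᵥ (g⁻¹.1 *ᵥ x) = x := by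
    intro x
    rw [← hmul, mul_inv_cancel]
    exact one_mulVec x
  have hcancel' : ∀ x : Fin m → ℝ, g⁻¹.1 *ᵥ (g.1 *ᵥ x) = x := by
    intro x
    rw [← hmul, inv_mul_cancel]
    exact one_mulVec x
  have hnorm : e ⬝ᵥ e = (g⁻¹.1 *ᵥ e) ⬝ᵥ (g⁻¹.1 *ᵥ e) := by
    rw [dotProduct_mulVec, ← mulVec_transpose, mulVec_mulVec,
      transpose_mul_self_of_mem g⁻¹.2, one_mulVec]
  obtain ⟨C, hC, hCe, hcomm⟩ := exists_rotation_commute (by simpa using hm)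
    (lastVector_ne_zero hkm) hnorm
  refine ⟨g * ⟨C, hC⟩, ?_, fun b hb => ?_⟩
  · rw [mem_range_specialOrthogonalEmbedding_iff, hmul]
    change g.1 *ᵥ (C *ᵥ e) = e
    rw [hCe, hcancel]
  · have hbe := (mem_range_specialOrthogonalEmbedding_iff hkm b).mp (h₁ hb)
    have hgb := (mem_range_specialOrthogonalEmbedding_iff hkm (g * b * g⁻¹)).mp
      (h₂ (hg ▸ Set.mem_image_of_mem _ hb))
    rw [hmul, hmul] at hgb
    -- Apply g⁻¹ to gbg⁻¹e = e.
    have hbv : b.1 *ᵥ (g⁻¹.1 *ᵥ e) = g⁻¹.1 *ᵥ e := by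
      conv_rhs => rw [he, ← hgb, hcancel']
    have hbC : b * ⟨C, hC⟩ = ⟨C, hC⟩ * b :=
      Subtype.ext (hcomm b.1 (transpose_mul_self_of_mem b.2) hbe hbv)
    rw [_root_.mul_inv_rev, mul_assoc g _ b, ← hbC]
    group

theorem mainTheorem7 (n : ℕ) (hn : 2 ≤ n) :
    StronglyControlsFusion
      (specialOrthogonalEmbedding (k := 2 * n - 1) (m := 2 * n) (by omega)).range :=
  stronglyControlsFusion_range_specialOrthogonalEmbedding _ (even_two_mul n)
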